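/- Let $N\ge 2$, let $\Omega\subset\mathbb{R}^N$ be a bounded domain (a nonempty, bounded, connected open set), and let $s\in(0,1)$. For measurable $u:\mathbb{R}^N\to\mathbb{R}$ set \[ [u]_s=\Big(\iint_{\mathbb{R}^N\times\mathbb{R}^N}\frac{|u(x)-u(y)|^2}{|x-y|^{N+2s}}\,dx\,dy\Big)^{1/2}\in[0,\infty]. \] Let \[ X=\{u\in H^1(\mathbb{R}^N):\ u=0\ \text{a.e. in}\ \mathbb{R}^N\setminus\Omega\},\qquad \|u\|_X=\|\nabla u\|_{L^2(\mathbb{R}^N)}, \] where $H^1(\mathbb{R}^N)$ is the space of real-valued $u\in L^2(\mathbb{R}^N)$ whose weak gradient $\nabla u$ lies in $L^2(\mathbb{R}^N;\mathbb{R}^N)$ (if $\partial\Omega$ is of class $C^1$, then $X$ consists of the extensions by $0$ of the functions in $H^1_0(\Omega)$), and let \[ Y=\{u\in L^2(\mathbb{R}^N):\ [u]_s<\infty,\ u=0\ \text{a.e. in}\ \mathbb{R}^N\setminus\Omega\},\qquad \|u\|_Y=[u]_s. \] Then $X$ is compactly embedded into $Y$: $X\subset Y$, and the inclusion map $X\to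 Y$, $u\mapsto u$, is a continuous and compact linear operator with respect to the norms $\|\cdot\|_X$ and $\|\cdot\|_Y$. -/

import Mathlib

noncomputable section

namespace MixedSobolev

open MeasureTheory Filter Topology
open scoped ENNReal ContDiff

/-- Euclidean space `ℝ^N`. -/
abbrev E (N : ℕ) : Type := EuclideanSpace ℝ (Fin N)

/-- The real Lebesgue space `L²(ℝ^N)`. -/
abbrev L2 (N : ℕ) : Type := Lp ℝ 2 (volume : Measure (E N))

/-- The space `L²(ℝ^N; ℝ^N)` of square integrable vector fields. -/
abbrev L2Vec (N : ℕ) : Type := Lp (E N) 2 (volume : Measure (E N))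

/-- `G` is the weak gradient of `u`: for every test function `φ ∈ C_c^∞(ℝ^N)` and every `i`,
`∫ u ∂ᵢφ = - ∫ Gᵢ φ`. -/
def IsWeakGradient {N : ℕ} (u : L2 N) (G : L2Vec N) : Prop :=
  ∀ φ : E N → ℝ, ContDiff ℝ ∞ φ → HasCompactSupport φ → ∀ i : Fin N,
    ∫ x, u x * fderiv ℝ φ x (EuclideanSpace.single i 1) = -∫ x, G x i * φ x

/-- `[u]_s = (∬ |u(x) - u(y)|² / |x - y|^(N + 2s) dx dy)^(1/2)`, as an element of `[0, ∞]`. -/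
def gagliardo {N : ℕ} (s : ℝ) (u : E N → ℝ) : ℝ≥0∞ :=
  (∫⁻ p : E N × E N, ‖u p.1 - u p.2‖ₑ ^ (2 : ℝ) / ‖p.1 - p.2‖ₑ ^ ((N : ℝ) + 2 * s)) ^ (1 / 2 : ℝ)

/-! ### Facts needed for the vector space structures and the norms -/

section WeakGradient

variable {N : ℕ}

theorem integrable_mul_test {u : E N → ℝ} (hu : MemLp u 2 volume) {ψ : E N → ℝ}
    (hψ : Continuous ψ) (hc : HasCompactSupport ψ) : Integrable (fun x => u x * ψ x) :=
  hu.integrable_mul (q := 2) (hψ.memLp_of_hasCompactSupport hc)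

theorem memLp_coord (G : L2Vec N) (i : Fin N) : MemLp (fun x => G x i) 2 volume :=
  (EuclideanSpace.proj i : E N →L[ℝ] ℝ).comp_memLp' (Lp.memLp G)

theorem continuous_partial {φ : E N → ℝ} (hφ : ContDiff ℝ ∞ φ) (v : E N) :
    Continuous (fun x => fderiv ℝ φ x v) :=
  (hφ.continuous_fderiv (by simp)).clm_apply continuous_const

theorem hasCompactSupport_partial {φ : E N → ℝ} (hc : HasCompactSupport φ) (v : E N) :
    HasCompactSupport (fun x => fderiv ℝ φ x v) :=
  hc.fderiv_apply (𝕜 := ℝ) v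

theorem IsWeakGradient.add {u v : L2 N} {G H : L2Vec N} (hu : IsWeakGradient u G)
    (hv : IsWeakGradient v H) : IsWeakGradient (u + v) (G + H) := by
  intro φ hφ hc i
  have h1 : ∫ x, (u + v : L2 N) x * fderiv ℝ φ x (EuclideanSpace.single i 1)
      = ∫ x, (u x * fderiv ℝ φ x (EuclideanSpace.single i 1)
          + v x * fderiv ℝ φ x (EuclideanSpace.single i 1)) := by
    refine integral_congr_ae ?_
    filter_upwards [Lp.coeFn_add u v] with x hx
    rw [hx, Pi.add_apply, add_mul]
  have h2 : ∫ x, (G + H : L2Vec N) x i * φ x = ∫ x, (G x i * φ x + H x i * φ x) := by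
    refine integral_congr_ae ?_
    filter_upwards [Lp.coeFn_add G H] with x hx
    rw [hx, Pi.add_apply, PiLp.add_apply, add_mul]
  rw [h1, h2, integral_add, integral_add, hu φ hφ hc i, hv φ hφ hc i, neg_add]
  · exact integrable_mul_test (memLp_coord G i) hφ.continuous hc
  · exact integrable_mul_test (memLp_coord H i) hφ.continuous hc
  · exact integrable_mul_test (Lp.memLp u) (continuous_partial hφ _)
      (hasCompactSupport_partial hc _)
  · exact integrable_mul_test (Lp.memLp v) (continuous_partial hφ _)
      (hasCompactSupport_partial hc _)

theorem IsWeakGradient.smul {u : L2 N} {G : L2Vec N} (c : ℝ) (hu : IsWeakGradient u G) :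
    IsWeakGradient (c • u) (c • G) := by
  intro φ hφ hc i
  have h1 : ∫ x, (c • u : L2 N) x * fderiv ℝ φ x (EuclideanSpace.single i 1)
      = ∫ x, c * (u x * fderiv ℝ φ x (EuclideanSpace.single i 1)) := by
    refine integral_congr_ae ?_
    filter_upwards [Lp.coeFn_smul c u] with x hx
    rw [hx, Pi.smul_apply, smul_eq_mul, mul_assoc]
  have h2 : ∫ x, (c • G : L2Vec N) x i * φ x = ∫ x, c * (G x i * φ x) := by
    refine integral_congr_ae ?_
    filter_upwards [Lp.coeFn_smul c G] with x hx
    rw [hx, Pi.smul_apply, PiLp.smul_apply, smul_eq_mul, mul_assoc]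
  rw [h1, h2, integral_const_mul, integral_const_mul, hu φ hφ hc i, mul_neg]

/-- Weak gradients are unique. -/
theorem IsWeakGradient.unique {u : L2 N} {G H : L2Vec N} (hG : IsWeakGradient u G)
    (hH : IsWeakGradient u H) : G = H := by
  have key : ∀ i : Fin N, ∀ᵐ x ∂(volume : Measure (E N)), G x i = H x i := by
    intro i
    refine ae_eq_of_integral_contDiff_smul_eq
      ((memLp_coord G i).locallyIntegrable (by norm_num))
      ((memLp_coord H i).locallyIntegrable (by norm_num)) ?_
    intro φ hφ hc
    have := (hG φ hφ hc i).symm.trans (hH φ hφ hc i)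
    simpa [mul_comm] using this
  refine Lp.ext ?_
  filter_upwards [ae_all_iff.2 key] with x hx
  ext i
  exact hx i

end WeakGradient

section Gagliardo

variable {N : ℕ}

theorem gagliardo_congr (s : ℝ) {u v : E N → ℝ} (h : u =ᵐ[volume] v) :
    gagliardo s u = gagliardo s v := by
  unfold gagliardo
  congr 1
  refine lintegral_congr_ae ?_
  have h1 : ∀ᵐ p : E N × E N, u p.1 = v p.1 := Measure.quasiMeasurePreserving_fst.ae h
  have h2 : ∀ᵐ p : E N × E N, u p.2 = v p.2 := Measure.quasiMeasurePreserving_snd.ae h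
  filter_upwards [h1, h2] with p hp hq
  rw [hp, hq]

theorem gagliardo_zero (s : ℝ) : gagliardo s (0 : E N → ℝ) = 0 := by
  simp [gagliardo]

theorem gagliardo_eq (s : ℝ) (u : E N → ℝ) :
    gagliardo s u = (∫⁻ p : E N × E N, (‖u p.1 - u p.2‖ₑ *
      (‖p.1 - p.2‖ₑ ^ ((N : ℝ) + 2 * s))⁻¹ ^ (1 / 2 : ℝ)) ^ (2 : ℝ)) ^ (1 / 2 : ℝ) := by
  unfold gagliardo
  congr 2
  ext p
  rw [ENNReal.mul_rpow_of_nonneg _ _ (by norm_num), ← ENNReal.rpow_mul, div_eq_mul_inv]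
  norm_num

theorem gagliardo_add_le (s : ℝ) {u v : E N → ℝ} (hu : AEStronglyMeasurable u volume)
    (hv : AEStronglyMeasurable v volume) :
    gagliardo s (u + v) ≤ gagliardo s u + gagliardo s v := by
  have hm : ∀ w : E N → ℝ, AEStronglyMeasurable w volume →
      AEMeasurable (fun p : E N × E N => ‖w p.1 - w p.2‖ₑ *
        (‖p.1 - p.2‖ₑ ^ ((N : ℝ) + 2 * s))⁻¹ ^ (1 / 2 : ℝ)) volume := by
    intro w hw
    have h1 : AEStronglyMeasurable (fun p : E N × E N => w p.1) volume :=
      hw.comp_quasiMeasurePreserving Measure.quasiMeasurePreserving_fst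
    have h2 : AEStronglyMeasurable (fun p : E N × E N => w p.2) volume :=
      hw.comp_quasiMeasurePreserving Measure.quasiMeasurePreserving_snd
    refine (h1.sub h2).enorm.mul ?_
    fun_prop
  rw [gagliardo_eq, gagliardo_eq, gagliardo_eq]
  refine le_trans ?_ (ENNReal.lintegral_Lp_add_le (p := 2) (hm u hu) (hm v hv) (by norm_num))
  gcongr with p
  refine le_trans ?_ (le_of_eq (add_mul _ _ _))
  gcongr
  calc ‖(u + v) p.1 - (u + v) p.2‖ₑ = ‖(u p.1 - u p.2) + (v p.1 - v p.2)‖ₑ := by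
        congr 1
        simp only [Pi.add_apply]
        ring
    _ ≤ _ := enorm_add_le _ _

theorem gagliardo_smul (s c : ℝ) (u : E N → ℝ) :
    gagliardo s (c • u) = ‖c‖ₑ * gagliardo s u := by
  unfold gagliardo
  have : ∀ p : E N × E N,
      ‖(c • u) p.1 - (c • u) p.2‖ₑ ^ (2 : ℝ) / ‖p.1 - p.2‖ₑ ^ ((N : ℝ) + 2 * s)
      = ‖c‖ₑ ^ (2 : ℝ) * (‖u p.1 - u p.2‖ₑ ^ (2 : ℝ) / ‖p.1 - p.2‖ₑ ^ ((N : ℝ) + 2 * s)) := by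
    intro p
    rw [Pi.smul_apply, Pi.smul_apply, ← smul_sub, smul_eq_mul, enorm_mul,
      ENNReal.mul_rpow_of_nonneg _ _ (by norm_num), mul_div_assoc]
  simp_rw [this]
  rw [lintegral_const_mul' _ _ (by simp),
    ENNReal.mul_rpow_of_nonneg _ _ (by norm_num), ← ENNReal.rpow_mul]
  norm_num

theorem gagliardo_lp_add_le (s : ℝ) (u v : L2 N) :
    gagliardo s (u + v : L2 N) ≤ gagliardo s u + gagliardo s v := by
  rw [gagliardo_congr s (Lp.coeFn_add u v)]
  exact gagliardo_add_le s (Lp.aestronglyMeasurable u) (Lp.aestronglyMeasurable v)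

theorem gagliardo_lp_smul (s c : ℝ) (u : L2 N) :
    gagliardo s (c • u : L2 N) = ‖c‖ₑ * gagliardo s u := by
  rw [gagliardo_congr s (Lp.coeFn_smul c u)]
  exact gagliardo_smul s c u

theorem gagliardo_lp_zero (s : ℝ) : gagliardo s (0 : L2 N) = 0 := by
  rw [gagliardo_congr s (Lp.coeFn_zero ℝ 2 volume), gagliardo_zero]

end Gagliardo

/-! ### The spaces -/

/-- `H¹(ℝ^N)`: the functions in `L²(ℝ^N)` with a weak gradient in `L²`. -/
def H1 (N : ℕ) : Submodule ℝ (L2 N) where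
  carrier := {u | ∃ G : L2Vec N, IsWeakGradient u G}
  add_mem' := fun ⟨G, hG⟩ ⟨H, hH⟩ => ⟨G + H, hG.add hH⟩
  zero_mem' := ⟨0, fun φ hφ hc i => by
    have h1 : ∫ x, (0 : L2 N) x * fderiv ℝ φ x (EuclideanSpace.single i 1) = 0 := by
      refine integral_eq_zero_of_ae ?_
      filter_upwards [Lp.coeFn_zero ℝ 2 (volume : Measure (E N))] with x hx
      rw [hx]; simp
    have h2 : ∫ x, (0 : L2Vec N) x i * φ x = 0 := by
      refine integral_eq_zero_of_ae ?_
      filter_upwards [Lp.coeFn_zero (E N) 2 (volume : Measure (E N))] with x hx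
      rw [hx]; simp
    rw [h1, h2, neg_zero]⟩
  smul_mem' := fun c _ ⟨G, hG⟩ => ⟨c • G, hG.smul c⟩

/-- `H^s(ℝ^N)`: the functions in `L²(ℝ^N)` with `[u]_s < ∞`. -/
def Hs (N : ℕ) (s : ℝ) : Submodule ℝ (L2 N) where
  carrier := {u | gagliardo s u < ⊤}
  add_mem' := fun {u v} hu hv =>
    (gagliardo_lp_add_le s u v).trans_lt (ENNReal.add_lt_top.2 ⟨hu, hv⟩)
  zero_mem' := (gagliardo_lp_zero s).trans_lt ENNReal.zero_lt_top
  smul_mem' := fun c u hu => by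
    simp only [Set.mem_ofPred_eq, gagliardo_lp_smul] at hu ⊢
    exact ENNReal.mul_lt_top enorm_lt_top hu

/-- The functions in `L²(ℝ^N)` that vanish a.e. in the complement of `Ω`. -/
def vanishingOutside {N : ℕ} (Ω : Set (E N)) : Submodule ℝ (L2 N) where
  carrier := {u | ∀ᵐ x, x ∉ Ω → u x = 0}
  add_mem' := fun {u v} hu hv => by
    filter_upwards [hu, hv, Lp.coeFn_add u v] with x h1 h2 h3 hx
    rw [h3, Pi.add_apply, h1 hx, h2 hx, add_zero]
  zero_mem' := by
    filter_upwards [Lp.coeFn_zero ℝ 2 (volume : Measure (E N))] with x h1 _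
    rw [h1, Pi.zero_apply]
  smul_mem' := fun c u hu => by
    filter_upwards [hu, Lp.coeFn_smul c u] with x h1 h2 hx
    rw [h2, Pi.smul_apply, h1 hx, smul_zero]

/-- The space `X = {u ∈ H¹(ℝ^N) : u = 0 a.e. in Ωᶜ}`. It carries the norm `‖∇u‖₂` below, and not
the norm of `L²(ℝ^N)`. -/
def X {N : ℕ} (Ω : Set (E N)) : Type := ↥(H1 N ⊓ vanishingOutside Ω)

/-- The space `Y = {u ∈ H^s(ℝ^N) : u = 0 a.e. in Ωᶜ}`. It carries the norm `[u]_s` below, and not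
the norm of `L²(ℝ^N)`. -/
def Y {N : ℕ} (s : ℝ) (Ω : Set (E N)) : Type := ↥(Hs N s ⊓ vanishingOutside Ω)

section Norms

variable {N : ℕ} {s : ℝ} {Ω : Set (E N)}

instance : AddCommGroup (X Ω) := inferInstanceAs (AddCommGroup ↥(H1 N ⊓ vanishingOutside Ω))

instance : Module ℝ (X Ω) := inferInstanceAs (Module ℝ ↥(H1 N ⊓ vanishingOutside Ω))

instance : AddCommGroup (Y s Ω) := inferInstanceAs (AddCommGroup ↥(Hs N s ⊓ vanishingOutside Ω))

instance : Module ℝ (Y s Ω) := inferInstanceAs (Module ℝ ↥(Hs N s ⊓ vanishingOutside Ω))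

/-- The element of `L²(ℝ^N)` underlying an element of `X`. -/
def X.toL2 (u : X Ω) : L2 N := Subtype.val u

/-- The element of `L²(ℝ^N)` underlying an element of `Y`. -/
def Y.toL2 (u : Y s Ω) : L2 N := Subtype.val u

/-- The weak gradient of an element of `X`. -/
def X.grad (u : X Ω) : L2Vec N := Classical.choose u.2.1

theorem X.isWeakGradient_grad (u : X Ω) : IsWeakGradient u.toL2 u.grad :=
  Classical.choose_spec u.2.1

theorem X.grad_add (u v : X Ω) : (u + v).grad = u.grad + v.grad :=
  (u + v).isWeakGradient_grad.unique (u.isWeakGradient_grad.add v.isWeakGradient_grad)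

theorem X.grad_smul (c : ℝ) (u : X Ω) : (c • u).grad = c • u.grad :=
  (c • u).isWeakGradient_grad.unique (u.isWeakGradient_grad.smul c)

/-- `‖u‖ = ‖∇u‖₂` on `X`. -/
instance : Norm (X Ω) := ⟨fun u => ‖u.grad‖⟩

/-- `‖u‖ = [u]_s` on `Y`, where it is finite. -/
instance : Norm (Y s Ω) := ⟨fun u => (gagliardo s u.toL2).toReal⟩

theorem X.core : SeminormedSpace.Core ℝ (X Ω) where
  norm_nonneg u := norm_nonneg u.grad
  norm_smul c u := by
    change ‖(c • u).grad‖ = ‖c‖ * ‖u.grad‖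
    rw [X.grad_smul, norm_smul]
  norm_triangle u v := by
    change ‖(u + v).grad‖ ≤ ‖u.grad‖ + ‖v.grad‖
    rw [X.grad_add]
    exact norm_add_le _ _

theorem Y.core : SeminormedSpace.Core ℝ (Y s Ω) where
  norm_nonneg u := ENNReal.toReal_nonneg
  norm_smul c u := by
    change (gagliardo s (c • u.toL2 : L2 N)).toReal = ‖c‖ * (gagliardo s u.toL2).toReal
    rw [gagliardo_lp_smul, ENNReal.toReal_mul, toReal_enorm]
  norm_triangle u v := by
    change (gagliardo s (u.toL2 + v.toL2 : L2 N)).toReal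
      ≤ (gagliardo s u.toL2).toReal + (gagliardo s v.toL2).toReal
    have hu : gagliardo s u.toL2 ≠ ⊤ := ne_of_lt u.2.1
    have hv : gagliardo s v.toL2 ≠ ⊤ := ne_of_lt v.2.1
    rw [← ENNReal.toReal_add hu hv]
    exact ENNReal.toReal_mono (ENNReal.add_ne_top.2 ⟨hu, hv⟩) (gagliardo_lp_add_le s _ _)

/-- The topology and metric of `X` come from `‖∇u‖₂`. This needs no assumption on `Ω`; for bounded
`Ω` (and `N ≥ 1`) the seminorm is a norm. -/
instance : SeminormedAddCommGroup (X Ω) := SeminormedAddCommGroup.ofCore (𝕜 := ℝ) X.core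

instance : NormedSpace ℝ (X Ω) where
  norm_smul_le c u := (X.core.norm_smul c u).le

/-- The topology and metric of `Y` come from `[u]_s`. This needs no assumption on `Ω`; for bounded
`Ω` (and `N ≥ 1`) the seminorm is a norm. -/
instance : SeminormedAddCommGroup (Y s Ω) := SeminormedAddCommGroup.ofCore (𝕜 := ℝ) Y.core

instance : NormedSpace ℝ (Y s Ω) where
  norm_smul_le c u := (Y.core.norm_smul c u).le

end Norms

end MixedSobolev

end

/-!
Write `τ_h u = u(h + ·)`. Testing against `C_c^∞` functions, which are dense in `L²`, a weak
gradient `G` of `u` gives `‖τ_h u - u‖₂ ≤ ‖G‖₂ |h|`. The square of the Gagliardo seminorm is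
`∫ ‖τ_h u - u‖₂² |h|^(-N-2s) dh`. If `‖τ_h u - u‖₂ ≤ K |h|`, the integrand is controlled by
`K² min(|h|, r)² |h|^(-N-2s)` with `r = 2‖u‖₂ / K`, so `[u]_s² ≤ C K^(2s) (2‖u‖₂)^(2-2s)`.
The functions supported in `Ω` with `‖τ_h u - u‖₂ ≤ |h|` form a closed set in `L²`, which is bounded
because a large translation moves the support off itself, and hence compact by the Kolmogorov–Riesz
theorem. By the interpolation inequality `[·]_s` controls differences in this set, so its image in
`Y` is compact, and this image contains the unit ball of `X`.
-/

noncomputable section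

namespace MixedSobolev

open MeasureTheory Filter Topology
open scoped ENNReal ContDiff Convolution

section Lp

variable {α F : Type*} [MeasurableSpace α] [NormedAddCommGroup F] {μ : Measure α} {p : ℝ≥0∞}

theorem enorm_rpow_toReal_eq_lintegral (hp0 : p ≠ 0) (hp : p ≠ ⊤) (f : Lp F p μ) :
    ‖f‖ₑ ^ p.toReal = ∫⁻ x, ‖f x‖ₑ ^ p.toReal ∂μ := by
  rw [Lp.enorm_def, eLpNorm_eq_lintegral_rpow_enorm_toReal hp0 hp, one_div,
    ENNReal.rpow_inv_rpow (ENNReal.toReal_pos hp0 hp).ne']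

theorem isClosed_setOf_ae_eq_zero_of_notMem [Fact (1 ≤ p)] (s : Set α) :
    IsClosed {f : Lp F p μ | ∀ᵐ x ∂μ, x ∉ s → f x = 0} := by
  refine IsSeqClosed.isClosed fun f g hf hfg => ?_
  obtain ⟨n, -, hn⟩ := (tendstoInMeasure_of_tendsto_Lp hfg).exists_seq_tendsto_ae
  filter_upwards [hn, ae_all_iff.2 hf] with x hx hfx hxs
  refine tendsto_nhds_unique hx ?_
  simp only [hfx _ hxs, tendsto_const_nhds_iff]

theorem enorm_sub_average_rpow_le [NormedSpace ℝ F] [CompleteSpace F] (hp1 : 1 ≤ p) (hp : p ≠ ⊤)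
    {s : Set α} (h0 : μ s ≠ 0) (ht : μ s ≠ ⊤) {f : α → F} (hf : MemLp f p μ) (c : F) :
    ‖c - ⨍ y in s, f y ∂μ‖ₑ ^ p.toReal ≤ (μ s)⁻¹ * ∫⁻ y in s, ‖f y - c‖ₑ ^ p.toReal ∂μ := by
  set ν : Measure α := (μ s)⁻¹ • μ.restrict s with hν
  have : IsProbabilityMeasure ν := ⟨by
    rw [hν, Measure.smul_apply, Measure.restrict_apply_univ, smul_eq_mul,
      ENNReal.inv_mul_cancel h0 ht]⟩
  have hfν : MemLp f p ν := (hf.restrict s).smul_measure (ENNReal.inv_ne_top.2 h0)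
  have hmean : c - ⨍ y in s, f y ∂μ = -∫ y, (f y - c) ∂ν := by
    rw [average_eq', Measure.restrict_apply_univ,
      integral_sub (hfν.integrable hp1) (integrable_const c), integral_const, probReal_univ,
      one_smul, neg_sub]
  have hp0 : p ≠ 0 := (zero_lt_one.trans_le hp1).ne'
  calc ‖c - ⨍ y in s, f y ∂μ‖ₑ ^ p.toReal
      ≤ eLpNorm (fun y => f y - c) 1 ν ^ p.toReal := by
        rw [hmean, enorm_neg, eLpNorm_one_eq_lintegral_enorm]
        gcongr
        exact enorm_integral_le_lintegral_enorm _
    _ ≤ eLpNorm (fun y => f y - c) p ν ^ p.toReal := by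
        gcongr
        exact eLpNorm_le_eLpNorm_of_exponent_le hp1 (hfν.sub (memLp_const c)).aestronglyMeasurable
    _ = (μ s)⁻¹ * ∫⁻ y in s, ‖f y - c‖ₑ ^ p.toReal ∂μ := by
        rw [eLpNorm_eq_lintegral_rpow_enorm_toReal hp0 hp, one_div,
          ENNReal.rpow_inv_rpow (ENNReal.toReal_pos hp0 hp).ne', hν, lintegral_smul_measure,
          smul_eq_mul]

end Lp

section Translation

variable {V F : Type*} [NormedAddCommGroup V] [MeasurableSpace V] [BorelSpace V]
  [NormedAddCommGroup F] {μ : Measure V} [μ.IsAddLeftInvariant] {p : ℝ≥0∞}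

theorem translate_sub_ae_eq (u : Lp F p μ) (v : V) :
    ⇑((DomAddAct.mk v +ᵥ u) - u) =ᵐ[μ] fun x => u (v + x) - u x := by
  filter_upwards [Lp.coeFn_sub (DomAddAct.mk v +ᵥ u) u,
    DomAddAct.vadd_Lp_ae_eq (DomAddAct.mk v) u] with x hsub htranslate
  rw [hsub, Pi.sub_apply, htranslate]
  rfl

theorem norm_le_norm_translate_sub {Ω : Set V} {R : ℝ} (hΩ : Ω ⊆ Metric.closedBall 0 R)
    {u : Lp F p μ} (hu : ∀ᵐ x ∂μ, x ∉ Ω → u x = 0) {v : V} (hv : 2 * R < ‖v‖) :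
    ‖u‖ ≤ ‖(DomAddAct.mk v +ᵥ u) - u‖ := by
  refine Lp.norm_le_norm_of_ae_le ?_
  filter_upwards [translate_sub_ae_eq u v, hu,
    (measurePreserving_add_left μ v).quasiMeasurePreserving.ae hu] with x hx hux huvx
  by_cases hxΩ : x ∈ Ω
  · have hvx : v + x ∉ Ω := fun hvx => by
      have h1 : ‖v + x‖ ≤ R := by simpa using hΩ hvx
      have h2 : ‖x‖ ≤ R := by simpa using hΩ hxΩ
      have h3 : ‖v‖ ≤ ‖v + x‖ + ‖x‖ := by simpa using norm_sub_le (v + x) x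
      linarith
    rw [hx, huvx hvx, zero_sub, norm_neg]
  · rw [hux hxΩ, norm_zero]
    exact norm_nonneg _

variable [Fact (1 ≤ p)]

theorem lintegral_translate_sub_rpow (hp : p ≠ ⊤) (u : Lp F p μ) (v : V) :
    ∫⁻ x, ‖u (v + x) - u x‖ₑ ^ p.toReal ∂μ = ‖(DomAddAct.mk v +ᵥ u) - u‖ₑ ^ p.toReal := by
  rw [enorm_rpow_toReal_eq_lintegral (zero_lt_one.trans_le Fact.out).ne' hp]
  refine lintegral_congr_ae ?_
  filter_upwards [translate_sub_ae_eq u v] with x hx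
  rw [hx]

/-- `u` is Lipschitz with constant `K` in the `Lᵖ`-mean: `‖u(v + ·) - u‖_p ≤ K ‖v‖` for all `v`.
This replaces the weak gradient in everything but the first estimate, because it is a closed
condition on `u`. -/
def TranslationLipschitz (K : ℝ) (u : Lp F p μ) : Prop :=
  ∀ v : V, ‖(DomAddAct.mk v +ᵥ u) - u‖ ≤ K * ‖v‖

theorem isClosed_setOf_translationLipschitz (K : ℝ) :
    IsClosed {u : Lp F p μ | TranslationLipschitz K u} := by
  simp only [TranslationLipschitz, Set.ofPred_forall]
  refine isClosed_iInter fun v => isClosed_le ?_ continuous_const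
  exact (((isometry_vadd _ (DomAddAct.mk v)).continuous).sub continuous_id).norm

theorem TranslationLipschitz.sub {K L : ℝ} {u w : Lp F p μ} (hu : TranslationLipschitz K u)
    (hw : TranslationLipschitz L w) : TranslationLipschitz (K + L) (u - w) := by
  intro v
  calc ‖(DomAddAct.mk v +ᵥ (u - w)) - (u - w)‖
      = ‖((DomAddAct.mk v +ᵥ u) - u) - ((DomAddAct.mk v +ᵥ w) - w)‖ := by
        rw [DomAddAct.vadd_Lp_sub, sub_sub_sub_comm]
    _ ≤ ‖(DomAddAct.mk v +ᵥ u) - u‖ + ‖(DomAddAct.mk v +ᵥ w) - w‖ := norm_sub_le _ _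
    _ ≤ (K + L) * ‖v‖ := by linarith [hu v, hw v]

theorem norm_translate_sub_le_two_mul (u : Lp F p μ) (v : V) :
    ‖(DomAddAct.mk v +ᵥ u) - u‖ ≤ 2 * ‖u‖ := by
  refine (norm_sub_le _ _).trans_eq ?_
  rw [DomAddAct.norm_vadd_Lp, two_mul]

theorem isBounded_setOf_translationLipschitz [NormedSpace ℝ V] [Nontrivial V] (K : ℝ) {Ω : Set V}
    (hΩ : Bornology.IsBounded Ω) :
    Bornology.IsBounded
      {u : Lp F p μ | (∀ᵐ x ∂μ, x ∉ Ω → u x = 0) ∧ TranslationLipschitz K u} := by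
  obtain ⟨R, hR⟩ := hΩ.subset_closedBall 0
  obtain ⟨v, hv⟩ := NormedSpace.exists_lt_norm ℝ V (2 * R)
  refine (Metric.isBounded_closedBall (x := (0 : Lp F p μ)) (r := K * ‖v‖)).subset ?_
  rintro u ⟨hu, hLip⟩
  rw [mem_closedBall_zero_iff]
  exact (norm_le_norm_translate_sub hR hu hv).trans (hLip v)

end Translation

section WeakGradient

theorem norm_le_of_dense_of_abs_inner_le {H : Type*} [NormedAddCommGroup H] [InnerProductSpace ℝ H]
    {S : Set H} (hS : Dense S) {w : H} {C : ℝ} (hC : 0 ≤ C)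
    (h : ∀ f ∈ S, |inner ℝ w f| ≤ C * ‖f‖) : ‖w‖ ≤ C := by
  rw [← innerSL_apply_norm (𝕜 := ℝ)]
  refine ContinuousLinearMap.opNorm_le_bound _ hC fun f => ?_
  exact hS.induction (P := fun f => ‖innerSL ℝ w f‖ ≤ C * ‖f‖) h
    (isClosed_le (by fun_prop) (by fun_prop)) f

theorem abs_integral_inner_mul_le {α W : Type*} [MeasurableSpace α] {μ : Measure α}
    [NormedAddCommGroup W] [InnerProductSpace ℝ W] (G : Lp W 2 μ) (v : W) {ψ : α → ℝ}
    (hψ : MemLp ψ 2 μ) :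
    |∫ x, inner ℝ v (G x) * ψ x ∂μ| ≤ ‖G‖ * ‖v‖ * lpNorm ψ 2 μ := by
  set D : Lp ℝ 2 μ := (innerSL ℝ v).compLp G with hD
  have hDG : ‖D‖ ≤ ‖G‖ * ‖v‖ := by
    rw [mul_comm, ← innerSL_apply_norm (𝕜 := ℝ) v]
    exact (innerSL ℝ v).norm_compLp_le G
  have hinner : ∫ x, inner ℝ v (G x) * ψ x ∂μ = inner ℝ hψ.toLp D := by
    rw [L2.inner_def]
    refine integral_congr_ae ?_
    filter_upwards [(innerSL ℝ v).coeFn_compLp G, hψ.coeFn_toLp] with x hx hψx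
    rw [hD, hx, hψx]
    rfl
  calc |∫ x, inner ℝ v (G x) * ψ x ∂μ| ≤ ‖hψ.toLp‖ * ‖D‖ := by
        rw [hinner]
        exact abs_real_inner_le_norm _ _
    _ ≤ ‖G‖ * ‖v‖ * lpNorm ψ 2 μ := by
        rw [mul_comm, Lp.norm_toLp, toReal_eLpNorm hψ.aestronglyMeasurable]
        exact mul_le_mul_of_nonneg_right hDG lpNorm_nonneg

variable {N : ℕ} {u : L2 N} {G : L2Vec N} {φ : E N → ℝ}

theorem IsWeakGradient.integral_fderiv (hG : IsWeakGradient u G) (hφ : ContDiff ℝ ∞ φ)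
    (hc : HasCompactSupport φ) (v : E N) :
    ∫ x, u x * fderiv ℝ φ x v = -∫ x, inner ℝ v (G x) * φ x := by
  have hv : v = ∑ i, v i • EuclideanSpace.single i (1 : ℝ) := by
    simpa using ((EuclideanSpace.basisFun (Fin N) ℝ).sum_repr v).symm
  have hpartial : ∀ x, u x * fderiv ℝ φ x v
      = ∑ i, v i * (u x * fderiv ℝ φ x (EuclideanSpace.single i 1)) := by
    intro x
    conv_lhs => rw [hv]
    simp only [map_sum, map_smul, smul_eq_mul, Finset.mul_sum, mul_left_comm]
  have hcoord : ∀ x, inner ℝ v (G x) * φ x = ∑ i, v i * (G x i * φ x) := by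
    intro x
    simp only [PiLp.inner_apply, Finset.sum_mul, RCLike.inner_apply, conj_trivial, mul_assoc,
      mul_left_comm]
  simp_rw [hpartial, hcoord]
  rw [integral_finsetSum, integral_finsetSum, ← Finset.sum_neg_distrib]
  · refine Finset.sum_congr rfl fun i _ => ?_
    rw [integral_const_mul, integral_const_mul, hG φ hφ hc i, mul_neg]
  · exact fun i _ => (integrable_mul_test (memLp_coord G i) hφ.continuous hc).const_mul _
  · exact fun i _ => (integrable_mul_test (Lp.memLp u) (continuous_partial hφ _)
      (hasCompactSupport_partial hc _)).const_mul _

theorem IsWeakGradient.hasDerivAt_integral_mul_translate (hG : IsWeakGradient u G)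
    (hφ : ContDiff ℝ ∞ φ) (hc : HasCompactSupport φ) (v : E N) (t : ℝ) :
    HasDerivAt (fun t : ℝ => ∫ x, u x * φ (x - t • v))
      (∫ x, inner ℝ v (G x) * φ (x - t • v)) t := by
  set ψ : E N → ℝ := fun x => φ (-x) with hψ
  have hψ_smooth : ContDiff ℝ 1 ψ := (hφ.comp contDiff_neg).of_le (by simp)
  have hψ_supp : HasCompactSupport ψ := hc.comp_homeomorph (Homeomorph.neg _)
  set χ : E N → ℝ := fun x => φ (x - t • v) with hχ
  have hχ_smooth : ContDiff ℝ ∞ χ := hφ.comp (contDiff_id.sub contDiff_const)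
  have hχ_supp : HasCompactSupport χ := hc.comp_homeomorph (Homeomorph.subRight (t • v))
  have hu : LocallyIntegrable u := (Lp.memLp u).locallyIntegrable one_le_two
  have hconv : ∀ t : ℝ, ∫ x, u x * φ (x - t • v)
      = (u ⋆[ContinuousLinearMap.mul ℝ ℝ, volume] ψ) (t • v) := by
    simp only [convolution_mul, hψ, neg_sub, implies_true]
  have hpartial : ∀ x, fderiv ℝ ψ (t • v - x) v = -fderiv ℝ χ x v := by
    intro x
    have hchain : HasFDerivAt ψ _ (t • v - x) :=
      (hφ.differentiable (by simp) _).hasFDerivAt.comp _ (hasFDerivAt_id _).neg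
    rw [hchain.fderiv, hχ, fderiv_comp_sub]
    simp
  have hderiv : ((u : E N → ℝ) ⋆[(ContinuousLinearMap.mul ℝ ℝ).precompR (E N), volume]
      fderiv ℝ ψ) (t • v) v = ∫ x, inner ℝ v (G x) * χ x := by
    rw [convolution_precompR_apply (ContinuousLinearMap.mul ℝ ℝ) hu (hψ_supp.fderiv ℝ)
      (hψ_smooth.continuous_fderiv one_ne_zero), convolution_mul]
    simp only [hpartial, mul_neg, integral_neg]
    rw [hG.integral_fderiv hχ_smooth hχ_supp, neg_neg]
  simp only [hconv]
  have hline := (hasDerivAt_id t).smul_const v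
  rw [one_smul] at hline
  rw [← hderiv]
  exact (hψ_supp.hasFDerivAt_convolution_right (ContinuousLinearMap.mul ℝ ℝ) hu hψ_smooth
    (t • v)).comp_hasDerivAt t hline

theorem IsWeakGradient.abs_integral_mul_translate_sub_le (hG : IsWeakGradient u G)
    (hφ : ContDiff ℝ ∞ φ) (hc : HasCompactSupport φ) (v : E N) :
    |(∫ x, u x * φ (x - v)) - ∫ x, u x * φ x| ≤ ‖G‖ * ‖v‖ * lpNorm φ 2 volume := by
  have hφ2 : MemLp φ 2 volume := hφ.continuous.memLp_of_hasCompactSupport hc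
  have hbound : ∀ t : ℝ,
      |∫ x, inner ℝ v (G x) * φ (x - t • v)| ≤ ‖G‖ * ‖v‖ * lpNorm φ 2 volume := by
    intro t
    have hmp := measurePreserving_sub_right (volume : Measure (E N)) (t • v)
    refine (abs_integral_inner_mul_le G v (hφ2.comp_measurePreserving hmp)).trans_eq ?_
    rw [← toReal_eLpNorm (hφ2.comp_measurePreserving hmp).1, ← toReal_eLpNorm hφ2.1,
      ← eLpNorm_comp_measurePreserving hφ2.1 hmp]
  simpa only [one_smul, zero_smul, sub_zero, Real.norm_eq_abs] using
    norm_image_sub_le_of_norm_deriv_le_segment_01'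
      (fun t _ => (hG.hasDerivAt_integral_mul_translate hφ hc v t).hasDerivWithinAt)
      (fun t _ => hbound t)

theorem inner_translate_sub_eq_integral (u f : L2 N) (hf : f =ᵐ[volume] φ) (hφ : ContDiff ℝ ∞ φ)
    (hc : HasCompactSupport φ) (v : E N) :
    inner ℝ ((DomAddAct.mk v +ᵥ u) - u) f = (∫ x, u x * φ (x - v)) - ∫ x, u x * φ x := by
  have hshift : Integrable fun x => u (v + x) * φ x := by
    have h := integrable_mul_test (Lp.memLp u) (ψ := fun x => φ (x - v))
      (hφ.continuous.comp (continuous_id.sub continuous_const))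
      (hc.comp_homeomorph (Homeomorph.subRight v))
    simpa only [add_sub_cancel_left] using h.comp_add_left v
  have hchange : ∫ x, u x * φ (x - v) = ∫ x, u (v + x) * φ x := by
    simpa only [add_sub_cancel_left] using
      (integral_add_left_eq_self (fun x => u x * φ (x - v)) v).symm
  rw [hchange, ← integral_sub hshift (integrable_mul_test (Lp.memLp u) hφ.continuous hc),
    L2.inner_def]
  refine integral_congr_ae ?_
  filter_upwards [translate_sub_ae_eq u v, hf] with x hx hfx
  rw [hx, hfx, ← sub_mul, mul_comm]
  rfl

theorem IsWeakGradient.translationLipschitz (hG : IsWeakGradient u G) :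
    TranslationLipschitz ‖G‖ u := by
  intro v
  refine norm_le_of_dense_of_abs_inner_le
    (Lp.dense_hasCompactSupport_contDiff (F := ℝ) (p := 2) (μ := (volume : Measure (E N)))
      ENNReal.ofNat_ne_top) (by positivity) ?_
  rintro f ⟨φ, hf, hc, hφ⟩
  rw [inner_translate_sub_eq_integral u f hf hφ hc, Lp.norm_def f, eLpNorm_congr_ae hf,
    toReal_eLpNorm hφ.continuous.aestronglyMeasurable]
  exact hG.abs_integral_mul_translate_sub_le hφ hc v

end WeakGradient

section Cells

variable {N : ℕ} {ε : ℝ}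

/-- The index of the half-open cube of side `ε`, with vertices in `ε ℤ^N`, that contains `x`. -/
def cellIndex (ε : ℝ) (x : E N) : Fin N → ℤ := fun i => ⌊x i / ε⌋

/-- The half-open cube of side `ε` with index `k`. Averaging over these cubes produces the finite
dimensional approximations in the Kolmogorov–Riesz theorem. -/
def cell (ε : ℝ) (k : Fin N → ℤ) : Set (E N) := {x | cellIndex ε x = k}

/-- The open cube of side `2 * ε` around `0`: it contains all differences of points that lie in a
common cell. -/
def cube (N : ℕ) (ε : ℝ) : Set (E N) := WithLp.ofLp ⁻¹' Metric.ball 0 ε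

theorem measurableSet_cell (ε : ℝ) (k : Fin N → ℤ) : MeasurableSet (cell ε k) := by
  have h : Measurable (cellIndex ε : E N → Fin N → ℤ) := by
    refine measurable_pi_lambda _ fun i => Int.measurable_floor.comp ?_
    fun_prop
  exact h (measurableSet_singleton k)

theorem measurableSet_cube (N : ℕ) (ε : ℝ) : MeasurableSet (cube N ε) :=
  (PiLp.volume_preserving_ofLp (Fin N)).measurable measurableSet_ball

theorem volume_cell (hε : 0 < ε) (k : Fin N → ℤ) :
    volume (cell ε k) = ENNReal.ofReal (ε ^ N) := by
  have h : cell ε k = WithLp.ofLp ⁻¹'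
      (Set.univ.pi fun i => Set.Ico ((k i : ℝ) * ε) (((k i : ℝ) + 1) * ε)) := by
    ext x
    simp only [cell, cellIndex, Set.mem_ofPred_eq, funext_iff, Int.floor_eq_iff, Set.mem_preimage,
      Set.mem_univ_pi, Set.mem_Ico, le_div_iff₀ hε, div_lt_iff₀ hε]
  rw [h, (PiLp.volume_preserving_ofLp (Fin N)).measure_preimage
    (MeasurableSet.univ_pi fun i => measurableSet_Ico).nullMeasurableSet, Real.volume_pi_Ico]
  simp [add_mul, ENNReal.ofReal_pow hε.le]

theorem volume_cell_ne_zero (hε : 0 < ε) (k : Fin N → ℤ) : volume (cell ε k) ≠ 0 := by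
  rw [volume_cell hε]
  positivity

theorem volume_cell_ne_top (hε : 0 < ε) (k : Fin N → ℤ) : volume (cell ε k) ≠ ⊤ := by
  rw [volume_cell hε]
  exact ENNReal.ofReal_ne_top

theorem volume_cube (hε : 0 < ε) (k : Fin N → ℤ) :
    volume (cube N ε) = 2 ^ N * volume (cell ε k) := by
  rw [cube, (PiLp.volume_preserving_ofLp (Fin N)).measure_preimage
    measurableSet_ball.nullMeasurableSet, Real.volume_pi_ball _ hε, volume_cell hε, mul_pow,
    Fintype.card_fin, ENNReal.ofReal_mul (by positivity), ENNReal.ofReal_pow zero_le_two,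
    ENNReal.ofReal_ofNat]

theorem mem_cube_of_cellIndex_add_eq (hε : 0 < ε) {x h : E N}
    (hx : cellIndex ε (h + x) = cellIndex ε x) : h ∈ cube N ε := by
  rw [cube, Set.mem_preimage, mem_ball_zero_iff, pi_norm_lt_iff hε]
  intro i
  have hi := Int.abs_sub_lt_one_of_floor_eq_floor (congrFun hx i)
  rwa [PiLp.add_apply, ← sub_div, add_sub_cancel_right, abs_div, abs_of_pos hε, div_lt_one hε] at hi

theorem exists_cube_subset {s : Set (E N)} (hs : s ∈ 𝓝 0) : ∃ ε > 0, cube N ε ⊆ s := by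
  have hnhds : 𝓝 (0 : E N) = comap WithLp.ofLp (𝓝 0) :=
    (PiLp.homeomorph 2 fun _ : Fin N => ℝ).nhds_eq_comap 0
  rw [hnhds] at hs
  exact (Metric.nhds_basis_ball.comap _).mem_iff.1 hs

theorem finite_image_cellIndex (hε : 0 < ε) {Ω : Set (E N)} (hΩ : Bornology.IsBounded Ω) :
    (cellIndex ε '' Ω).Finite := by
  obtain ⟨R, hR⟩ := hΩ.subset_closedBall 0
  refine (Set.finite_Icc (fun _ : Fin N => ⌊-R / ε⌋) (fun _ => ⌊R / ε⌋)).subset ?_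
  rintro _ ⟨x, hx, rfl⟩
  have hxi : ∀ i, |x i| ≤ R := fun i =>
    (PiLp.norm_apply_le x i).trans (mem_closedBall_zero_iff.1 (hR hx))
  exact ⟨fun i => Int.floor_le_floor (by gcongr; exact (abs_le.1 (hxi i)).1),
    fun i => Int.floor_le_floor (by gcongr; exact (abs_le.1 (hxi i)).2)⟩

end Cells

section KolmogorovRiesz

variable {N : ℕ} {ε : ℝ} {p : ℝ≥0∞}

theorem enorm_sub_cellAverage_rpow_le {F : Type*} [NormedAddCommGroup F] [NormedSpace ℝ F]
    [CompleteSpace F] (hp1 : 1 ≤ p) (hp : p ≠ ⊤) (hε : 0 < ε)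
    (u : Lp F p (volume : Measure (E N))) (x : E N) :
    ‖u x - ⨍ y in cell ε (cellIndex ε x), u y‖ₑ ^ p.toReal
      ≤ (volume (cell ε (0 : Fin N → ℤ)))⁻¹ *
        ∫⁻ h in cube N ε, ‖u (h + x) - u x‖ₑ ^ p.toReal := by
  set Q := cell ε (cellIndex ε x) with hQ
  have hvol : volume Q = volume (cell ε (0 : Fin N → ℤ)) := by
    rw [hQ, volume_cell hε, volume_cell hε]
  refine (enorm_sub_average_rpow_le hp1 hp (volume_cell_ne_zero hε _) (volume_cell_ne_top hε _)
    (Lp.memLp u) (u x)).trans ?_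
  rw [← hQ, hvol, ← lintegral_indicator (measurableSet_cell _ _),
    ← lintegral_indicator (measurableSet_cube _ _), ← lintegral_add_right_eq_self _ x]
  gcongr with h
  by_cases hh : h + x ∈ Q
  · rw [Set.indicator_of_mem hh, Set.indicator_of_mem (mem_cube_of_cellIndex_add_eq hε hh)]
  · rw [Set.indicator_of_notMem hh]
    exact zero_le

theorem lintegral_sub_cellAverage_rpow_le {F : Type*} [NormedAddCommGroup F] [NormedSpace ℝ F]
    [CompleteSpace F] [Fact (1 ≤ p)] (hp : p ≠ ⊤) (hε : 0 < ε)
    {u : Lp F p (volume : Measure (E N))} {M : ℝ≥0∞}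
    (hM : ∀ h ∈ cube N ε, ‖(DomAddAct.mk h +ᵥ u) - u‖ₑ ≤ M) :
    ∫⁻ x, ‖u x - ⨍ y in cell ε (cellIndex ε x), u y‖ₑ ^ p.toReal ≤ 2 ^ N * M ^ p.toReal := by
  set m := volume (cell ε (0 : Fin N → ℤ)) with hm
  have hm0 : m ≠ 0 := volume_cell_ne_zero hε 0
  have hmt : m ≠ ⊤ := volume_cell_ne_top hε 0
  have hu : StronglyMeasurable u := Lp.stronglyMeasurable u
  calc ∫⁻ x, ‖u x - ⨍ y in cell ε (cellIndex ε x), u y‖ₑ ^ p.toReal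
      ≤ ∫⁻ x, m⁻¹ * ∫⁻ h in cube N ε, ‖u (h + x) - u x‖ₑ ^ p.toReal :=
        lintegral_mono (enorm_sub_cellAverage_rpow_le Fact.out hp hε u)
    _ = m⁻¹ * ∫⁻ h in cube N ε, ∫⁻ x, ‖u (h + x) - u x‖ₑ ^ p.toReal := by
        rw [lintegral_const_mul' _ _ (ENNReal.inv_ne_top.2 hm0), lintegral_lintegral_swap]
        exact (((hu.comp_measurable (measurable_snd.add measurable_fst)).sub
          (hu.comp_measurable measurable_fst)).enorm.pow_const _).aemeasurable
    _ ≤ m⁻¹ * ∫⁻ _ in cube N ε, M ^ p.toReal := by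
        refine mul_le_mul_right ?_ _
        refine setLIntegral_mono' (measurableSet_cube N ε) fun h hh => ?_
        rw [lintegral_translate_sub_rpow hp]
        gcongr
        exact hM h hh
    _ = 2 ^ N * M ^ p.toReal := by
        rw [setLIntegral_const, volume_cube hε 0, ← hm, mul_left_comm (M ^ _), mul_left_comm m⁻¹,
          mul_comm _ m, ENNReal.inv_mul_cancel_left hm0 hmt]

/-- The indicator function of a cell as an element of `Lᵖ`. -/
def cellIndicator (p : ℝ≥0∞) (hε : 0 < ε) (k : Fin N → ℤ) : Lp ℝ p (volume : Measure (E N)) :=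
  indicatorConstLp p (measurableSet_cell ε k) (volume_cell_ne_top hε k) 1

theorem sum_smul_cellIndicator_ae_eq (hε : 0 < ε) (T : Finset (Fin N → ℤ))
    (a : (Fin N → ℤ) → ℝ) :
    ⇑(∑ k ∈ T, a k • cellIndicator p hε k) =ᵐ[volume]
      fun x => if cellIndex ε x ∈ T then a (cellIndex ε x) else 0 := by
  have hterm : ∀ᵐ x, ∀ k : Fin N → ℤ, (a k • cellIndicator p hε k) x
      = if cellIndex ε x = k then a k else 0 := by
    refine ae_all_iff.2 fun k => ?_
    filter_upwards [Lp.coeFn_smul (a k) (cellIndicator p hε k),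
      indicatorConstLp_coeFn (p := p) (hs := measurableSet_cell ε k)
        (hμs := volume_cell_ne_top hε k) (c := (1 : ℝ))] with x hsmul hind
    rw [hsmul, Pi.smul_apply, cellIndicator, hind, smul_eq_mul]
    by_cases hx : cellIndex ε x = k
    · rw [Set.indicator_of_mem (show x ∈ cell ε k from hx), mul_one, if_pos hx]
    · rw [Set.indicator_of_notMem (show x ∉ cell ε k from hx), mul_zero, if_neg hx]
  filter_upwards [hterm, Lp.coeFn_finsetSum T fun k => a k • cellIndicator p hε k] with x hx hsum
  rw [hsum, Finset.sum_apply]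
  simp_rw [hx]
  exact Finset.sum_ite_eq T _ _

theorem exists_mem_span_cellIndicator [Fact (1 ≤ p)] (hp : p ≠ ⊤) (hε : 0 < ε) {Ω : Set (E N)}
    {T : Finset (Fin N → ℤ)} (hT : ∀ x ∈ Ω, cellIndex ε x ∈ T)
    {u : Lp ℝ p (volume : Measure (E N))} (hu : ∀ᵐ x, x ∉ Ω → u x = 0) {M : ℝ≥0∞}
    (hM : ∀ h ∈ cube N ε, ‖(DomAddAct.mk h +ᵥ u) - u‖ₑ ≤ M) :
    ∃ g ∈ Submodule.span ℝ (cellIndicator p hε '' (T : Set (Fin N → ℤ))), ‖u - g‖ₑ ≤ 2 ^ N * M := by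
  set g := ∑ k ∈ T, (⨍ y in cell ε k, u y) • cellIndicator p hε k with hg
  refine ⟨g, Submodule.sum_mem _ fun k hk =>
    Submodule.smul_mem _ _ (Submodule.subset_span ⟨k, hk, rfl⟩), ?_⟩
  have hp1 : 1 ≤ p := Fact.out
  have hq : 1 ≤ p.toReal := ENNReal.toReal_mono hp hp1
  have hpt : ∀ᵐ x, ‖(u - g) x‖ₑ ≤ ‖u x - ⨍ y in cell ε (cellIndex ε x), u y‖ₑ := by
    filter_upwards [sum_smul_cellIndicator_ae_eq hε T fun k => ⨍ y in cell ε k, u y, hu,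
      Lp.coeFn_sub u g] with x hgx hux hsub
    rw [hsub, Pi.sub_apply, hg, hgx]
    split_ifs with hx
    · exact le_rfl
    · rw [hux fun hxΩ => hx (hT x hxΩ), sub_zero, enorm_zero]
      exact zero_le
  refine (ENNReal.rpow_le_rpow_iff (zero_lt_one.trans_le hq)).1 ?_
  calc ‖u - g‖ₑ ^ p.toReal = ∫⁻ x, ‖(u - g) x‖ₑ ^ p.toReal :=
        enorm_rpow_toReal_eq_lintegral (zero_lt_one.trans_le hp1).ne' hp _
    _ ≤ ∫⁻ x, ‖u x - ⨍ y in cell ε (cellIndex ε x), u y‖ₑ ^ p.toReal := by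
        refine lintegral_mono_ae (hpt.mono fun x hx => ?_)
        gcongr
    _ ≤ 2 ^ N * M ^ p.toReal := lintegral_sub_cellAverage_rpow_le hp hε hM
    _ ≤ (2 ^ N) ^ p.toReal * M ^ p.toReal := by
        gcongr
        exact ENNReal.le_rpow_self_of_one_le (one_le_pow₀ one_le_two) hq
    _ = (2 ^ N * M) ^ p.toReal := (ENNReal.mul_rpow_of_nonneg _ _ (zero_le_one.trans hq)).symm

theorem totallyBounded_of_forall_finiteDimensional {𝕜 V : Type*} [NontriviallyNormedField 𝕜]
    [LocallyCompactSpace 𝕜] [NormedAddCommGroup V] [NormedSpace 𝕜 V] {S : Set V}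
    (hS : Bornology.IsBounded S)
    (h : ∀ ε > 0, ∃ W : Submodule 𝕜 V, FiniteDimensional 𝕜 W ∧ ∀ u ∈ S, ∃ g ∈ W, ‖u - g‖ < ε) :
    TotallyBounded S := by
  obtain ⟨R, hR⟩ := hS.subset_closedBall 0
  refine Metric.totallyBounded_iff.2 fun ε hε => ?_
  obtain ⟨W, _, hW⟩ := h (ε / 2) (half_pos hε)
  have := FiniteDimensional.proper 𝕜 W
  have hball : TotallyBounded ((Subtype.val : W → V) '' Metric.closedBall 0 (R + ε / 2)) :=
    ((isCompact_closedBall 0 _).image continuous_subtype_val).totallyBounded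
  obtain ⟨t, ht, hcover⟩ := Metric.totallyBounded_iff.1 hball (ε / 2) (half_pos hε)
  refine ⟨t, ht, fun u hu => ?_⟩
  obtain ⟨g, hgW, hug⟩ := hW u hu
  have hgR : ‖g‖ ≤ R + ε / 2 := by
    have hgu : ‖g‖ ≤ ‖u‖ + ‖u - g‖ := by simpa using norm_sub_le u (u - g)
    linarith [mem_closedBall_zero_iff.1 (hR hu)]
  obtain ⟨y, hy, hgy⟩ := Set.mem_iUnion₂.1
    (hcover ⟨⟨g, hgW⟩, mem_closedBall_zero_iff.2 hgR, rfl⟩)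
  refine Set.mem_iUnion₂.2 ⟨y, hy, ?_⟩
  calc dist u y ≤ dist u g + dist g y := dist_triangle _ _ _
    _ < ε / 2 + ε / 2 := add_lt_add (by rwa [dist_eq_norm]) hgy
    _ = ε := add_halves ε

theorem totallyBounded_of_translate [Fact (1 ≤ p)] (hp : p ≠ ⊤)
    {S : Set (Lp ℝ p (volume : Measure (E N)))} (hS : Bornology.IsBounded S) {Ω : Set (E N)}
    (hΩ : Bornology.IsBounded Ω) (hvanish : ∀ u ∈ S, ∀ᵐ x, x ∉ Ω → u x = 0)
    (htranslate : ∀ ε > 0, ∀ᶠ h in 𝓝 (0 : E N), ∀ u ∈ S, ‖(DomAddAct.mk h +ᵥ u) - u‖ ≤ ε) :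
    TotallyBounded S := by
  refine totallyBounded_of_forall_finiteDimensional (𝕜 := ℝ) hS fun δ hδ => ?_
  have hη : 0 < δ / 2 ^ (N + 1) := by positivity
  obtain ⟨ε, hε, hcube⟩ := exists_cube_subset (htranslate _ hη)
  set T := (finite_image_cellIndex hε hΩ).toFinset
  refine ⟨Submodule.span ℝ (cellIndicator p hε '' (T : Set (Fin N → ℤ))),
    FiniteDimensional.span_of_finite ℝ (T.finite_toSet.image _), fun u hu => ?_⟩
  obtain ⟨g, hg, hug⟩ := exists_mem_span_cellIndicator hp hε (T := T)
    (fun x hx => (Set.Finite.mem_toFinset _).2 ⟨x, hx, rfl⟩) (hvanish u hu)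
    (M := ENNReal.ofReal (δ / 2 ^ (N + 1))) fun h hh => by
      rw [← ofReal_norm]
      exact ENNReal.ofReal_le_ofReal (hcube hh u hu)
  have hle : ‖u - g‖ ≤ 2 ^ N * (δ / 2 ^ (N + 1)) := by
    refine (ENNReal.ofReal_le_ofReal_iff (by positivity)).1 ?_
    rwa [ofReal_norm, ENNReal.ofReal_mul (by positivity), ENNReal.ofReal_pow zero_le_two,
      ENNReal.ofReal_ofNat]
  refine ⟨g, hg, hle.trans_lt ?_⟩
  calc (2 : ℝ) ^ N * (δ / 2 ^ (N + 1)) = δ / 2 := by field_simp; ring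
    _ < δ := half_lt_self hδ

theorem isCompact_setOf_translationLipschitz [Fact (1 ≤ p)] [NeZero N] (hp : p ≠ ⊤) (K : ℝ)
    {Ω : Set (E N)} (hΩ : Bornology.IsBounded Ω) :
    IsCompact {u : Lp ℝ p (volume : Measure (E N)) |
      (∀ᵐ x, x ∉ Ω → u x = 0) ∧ TranslationLipschitz K u} := by
  refine TotallyBounded.isCompact_of_isClosed
    (totallyBounded_of_translate hp (isBounded_setOf_translationLipschitz K hΩ) hΩ
      (fun u hu => hu.1) fun ε hε => ?_)
    ((isClosed_setOf_ae_eq_zero_of_notMem Ω).inter (isClosed_setOf_translationLipschitz K))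
  have hsmall : ∀ᶠ h in 𝓝 (0 : E N), K * ‖h‖ < ε :=
    (continuous_const.mul continuous_norm).continuousAt.eventually_lt_const (by simpa using hε)
  filter_upwards [hsmall] with h hh u hu
  exact (hu.2 h).trans hh.le

end KolmogorovRiesz

section Interpolation

variable {s r : ℝ}

theorem integrableOn_and_integral_Ioc_min_sq_mul_rpow (hs : s < 1) (hr : 0 < r) :
    IntegrableOn (fun y : ℝ => min y r ^ 2 * y ^ (-1 - 2 * s)) (Set.Ioc 0 r) ∧
      ∫ y in Set.Ioc 0 r, min y r ^ 2 * y ^ (-1 - 2 * s) = r ^ (2 - 2 * s) / (2 - 2 * s) := by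
  have heq : Set.EqOn (fun y : ℝ => y ^ (1 - 2 * s)) (fun y => min y r ^ 2 * y ^ (-1 - 2 * s))
      (Set.Ioc 0 r) := by
    intro y hy
    simp only [min_eq_left hy.2]
    rw [← Real.rpow_natCast, ← Real.rpow_add hy.1]
    congr 1
    push_cast
    ring
  refine ⟨((intervalIntegrable_iff_integrableOn_Ioc_of_le hr.le).1
    (intervalIntegral.intervalIntegrable_rpow' (by linarith))).congr_fun heq measurableSet_Ioc, ?_⟩
  rw [← setIntegral_congr_fun measurableSet_Ioc heq, ← intervalIntegral.integral_of_le hr.le,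
    integral_rpow (Or.inl (by linarith)), show 1 - 2 * s + 1 = 2 - 2 * s by ring,
    Real.zero_rpow (by linarith), sub_zero]

theorem integrableOn_and_integral_Ioi_min_sq_mul_rpow (hs : 0 < s) (hr : 0 < r) :
    IntegrableOn (fun y : ℝ => min y r ^ 2 * y ^ (-1 - 2 * s)) (Set.Ioi r) ∧
      ∫ y in Set.Ioi r, min y r ^ 2 * y ^ (-1 - 2 * s) = r ^ (2 - 2 * s) / (2 * s) := by
  have heq : Set.EqOn (fun y : ℝ => r ^ 2 * y ^ (-1 - 2 * s))
      (fun y => min y r ^ 2 * y ^ (-1 - 2 * s)) (Set.Ioi r) := by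
    intro y hy
    simp only [min_eq_right (Set.mem_Ioi.1 hy).le]
  refine ⟨IntegrableOn.congr_fun
    ((integrableOn_Ioi_rpow_of_lt (by linarith) hr).const_mul _) heq measurableSet_Ioi, ?_⟩
  rw [← setIntegral_congr_fun measurableSet_Ioi heq, integral_const_mul,
    integral_Ioi_rpow_of_lt (by linarith) hr, show -1 - 2 * s + 1 = -(2 * s) by ring,
    neg_div_neg_eq, ← mul_div_assoc, ← Real.rpow_natCast, ← Real.rpow_add hr, Nat.cast_ofNat,
    sub_eq_add_neg]

section Kernel

variable {V : Type*} [NormedAddCommGroup V] [NormedSpace ℝ V] [FiniteDimensional ℝ V]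
  [Nontrivial V] [MeasurableSpace V] [BorelSpace V] (μ : Measure V) [μ.IsAddHaarMeasure]

theorem integrable_and_integral_min_sq_div_norm_rpow (hs : s ∈ Set.Ioo (0 : ℝ) 1) (hr : 0 < r) :
    Integrable (fun h : V => min ‖h‖ r ^ 2 / ‖h‖ ^ (Module.finrank ℝ V + 2 * s)) μ ∧
      ∫ h : V, min ‖h‖ r ^ 2 / ‖h‖ ^ (Module.finrank ℝ V + 2 * s) ∂μ
        = Module.finrank ℝ V * μ.real (Metric.ball 0 1) / (2 * s * (1 - s)) * r ^ (2 - 2 * s) := by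
  have hpolar : Set.EqOn (fun y : ℝ => min y r ^ 2 * y ^ (-1 - 2 * s))
      (fun y => y ^ (Module.finrank ℝ V - 1) • (min y r ^ 2 / y ^ (Module.finrank ℝ V + 2 * s)))
      (Set.Ioi 0) := by
    intro y hy
    have hdim : ((Module.finrank ℝ V - 1 : ℕ) : ℝ) = Module.finrank ℝ V - 1 :=
      Nat.cast_pred Module.finrank_pos
    simp only [smul_eq_mul]
    rw [div_eq_mul_inv, ← Real.rpow_neg (le_of_lt hy), mul_left_comm, ← Real.rpow_natCast y,
      ← Real.rpow_add hy, hdim]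
    congr 2
    ring
  obtain ⟨hnear, hnear_eq⟩ := integrableOn_and_integral_Ioc_min_sq_mul_rpow hs.2 hr
  obtain ⟨hfar, hfar_eq⟩ := integrableOn_and_integral_Ioi_min_sq_mul_rpow hs.1 hr
  constructor
  · refine (integrable_fun_norm_addHaar μ
      (f := fun y => min y r ^ 2 / y ^ (Module.finrank ℝ V + 2 * s))).2 ?_
    refine IntegrableOn.congr_fun ?_ hpolar measurableSet_Ioi
    rw [← Set.Ioc_union_Ioi_eq_Ioi hr.le]
    exact hnear.union hfar
  · rw [integral_fun_norm_addHaar μ fun y => min y r ^ 2 / y ^ (Module.finrank ℝ V + 2 * s),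
      ← setIntegral_congr_fun measurableSet_Ioi hpolar, ← Set.Ioc_union_Ioi_eq_Ioi hr.le,
      setIntegral_union Set.Ioc_disjoint_Ioi_same measurableSet_Ioi hnear hfar, hnear_eq, hfar_eq,
      nsmul_eq_mul, smul_eq_mul]
    have hs0 : s ≠ 0 := hs.1.ne'
    have hs1 : 1 - s ≠ 0 := (sub_pos.2 hs.2).ne'
    have : 2 - 2 * s ≠ 0 := by linarith [hs.2]
    field_simp
    ring

end Kernel

theorem lintegral_prod_eq_lintegral_translate {V : Type*} [AddGroup V] [MeasurableSpace V]
    [MeasurableAdd₂ V] {μ : Measure V} [SFinite μ] [μ.IsAddRightInvariant] {F : V × V → ℝ≥0∞}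
    (hF : Measurable F) : ∫⁻ q, F q ∂μ.prod μ = ∫⁻ h, ∫⁻ x, F (h + x, x) ∂μ ∂μ := by
  calc ∫⁻ q, F q ∂μ.prod μ = ∫⁻ x, ∫⁻ h, F (h, x) ∂μ ∂μ := lintegral_prod_symm' F hF
    _ = ∫⁻ x, ∫⁻ h, F (h + x, x) ∂μ ∂μ :=
        lintegral_congr fun x => (lintegral_add_right_eq_self (fun h => F (h, x)) x).symm
    _ = ∫⁻ h, ∫⁻ x, F (h + x, x) ∂μ ∂μ := lintegral_lintegral_swap (by fun_prop)

variable {N : ℕ}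

theorem gagliardo_rpow_two (s : ℝ) (u : L2 N) :
    gagliardo s u ^ (2 : ℝ)
      = ∫⁻ h : E N, ‖(DomAddAct.mk h +ᵥ u) - u‖ₑ ^ (2 : ℝ) / ‖h‖ₑ ^ ((N : ℝ) + 2 * s) := by
  have : Measurable u := (Lp.stronglyMeasurable u).measurable
  rw [gagliardo, ← ENNReal.rpow_mul, one_div_mul_cancel two_ne_zero, ENNReal.rpow_one,
    Measure.volume_eq_prod, lintegral_prod_eq_lintegral_translate (by fun_prop)]
  refine lintegral_congr fun h => ?_
  have htranslate := lintegral_translate_sub_rpow ENNReal.ofNat_ne_top u h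
  rw [ENNReal.toReal_ofNat] at htranslate
  simp only [add_sub_cancel_right, div_eq_mul_inv]
  rw [lintegral_mul_const _ (by fun_prop), htranslate]

/-- The constant `C` in the bound `[u]_s² ≤ C K^(2s) (2‖u‖)^(2-2s)` for functions whose translates
satisfy `‖u(· + h) - u‖ ≤ K |h|`. -/
def interpolationConst (N : ℕ) (s : ℝ) : ℝ :=
  N * volume.real (Metric.ball (0 : E N) 1) / (2 * s * (1 - s))

theorem gagliardo_rpow_two_le_of_norm_translate_sub_le [NeZero N] (hs : s ∈ Set.Ioo (0 : ℝ) 1)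
    (hr : 0 < r) {K : ℝ} {u : L2 N}
    (hu : ∀ h : E N, ‖(DomAddAct.mk h +ᵥ u) - u‖ ≤ K * min ‖h‖ r) :
    gagliardo s u ^ (2 : ℝ)
      ≤ ENNReal.ofReal (K ^ 2 * (interpolationConst N s * r ^ (2 - 2 * s))) := by
  obtain ⟨hint, heq⟩ := integrable_and_integral_min_sq_div_norm_rpow (volume : Measure (E N)) hs hr
  rw [finrank_euclideanSpace_fin] at hint heq
  have hpt : ∀ h : E N, ‖(DomAddAct.mk h +ᵥ u) - u‖ₑ ^ (2 : ℝ) / ‖h‖ₑ ^ ((N : ℝ) + 2 * s)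
      ≤ ENNReal.ofReal (K ^ 2 * (min ‖h‖ r ^ 2 / ‖h‖ ^ ((N : ℝ) + 2 * s))) := by
    intro h
    rcases eq_or_ne h 0 with rfl | hh
    · simp
    · have hpos : 0 < ‖h‖ ^ ((N : ℝ) + 2 * s) := Real.rpow_pos_of_pos (norm_pos_iff.2 hh) _
      rw [← mul_div_assoc, ← mul_pow, ENNReal.ofReal_div_of_pos hpos, ENNReal.rpow_ofNat,
        ← ofReal_norm, ← ofReal_norm, ENNReal.ofReal_rpow_of_pos (norm_pos_iff.2 hh),
        ← ENNReal.ofReal_pow (norm_nonneg _)]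
      gcongr
      exact hu h
  calc gagliardo s u ^ (2 : ℝ)
      ≤ ∫⁻ h : E N, ENNReal.ofReal (K ^ 2 * (min ‖h‖ r ^ 2 / ‖h‖ ^ ((N : ℝ) + 2 * s))) := by
        rw [gagliardo_rpow_two]
        exact lintegral_mono hpt
    _ = ENNReal.ofReal (K ^ 2 * (interpolationConst N s * r ^ (2 - 2 * s))) := by
        rw [← ofReal_integral_eq_lintegral_ofReal (hint.const_mul _)
          (Eventually.of_forall fun h => by positivity), integral_const_mul, heq,
          interpolationConst]

theorem TranslationLipschitz.gagliardo_rpow_two_le [NeZero N] (hs : s ∈ Set.Ioo (0 : ℝ) 1) {K : ℝ}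
    (hK : 0 < K) {u : L2 N} (hu : TranslationLipschitz K u) :
    gagliardo s u ^ (2 : ℝ) ≤ ENNReal.ofReal
      (interpolationConst N s * K ^ (2 * s) * (2 * ‖u‖) ^ (2 - 2 * s)) := by
  rcases eq_or_ne u 0 with rfl | hu0
  · rw [gagliardo_lp_zero, ENNReal.zero_rpow_of_pos two_pos]
    exact zero_le
  set r := 2 * ‖u‖ / K
  have hr : 0 < r := by positivity
  have hKr : K * r = 2 * ‖u‖ := mul_div_cancel₀ _ hK.ne'
  have hmin : ∀ h : E N, ‖(DomAddAct.mk h +ᵥ u) - u‖ ≤ K * min ‖h‖ r := fun h => by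
    rw [mul_min_of_nonneg _ _ hK.le, hKr]
    exact le_min (hu h) (norm_translate_sub_le_two_mul u h)
  refine (gagliardo_rpow_two_le_of_norm_translate_sub_le hs hr hmin).trans_eq ?_
  congr 1
  calc K ^ 2 * (interpolationConst N s * r ^ (2 - 2 * s))
      = interpolationConst N s * K ^ (2 * s) * (K ^ (2 - 2 * s) * r ^ (2 - 2 * s)) := by
        rw [← Real.rpow_natCast, show ((2 : ℕ) : ℝ) = 2 * s + (2 - 2 * s) by push_cast; ring,
          Real.rpow_add hK]
        ring
    _ = interpolationConst N s * K ^ (2 * s) * (2 * ‖u‖) ^ (2 - 2 * s) := by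
        rw [← Real.mul_rpow hK.le hr.le, hKr]

theorem TranslationLipschitz.mem_Hs [NeZero N] (hs : s ∈ Set.Ioo (0 : ℝ) 1) {K : ℝ} {u : L2 N}
    (hu : TranslationLipschitz K u) : u ∈ Hs N s := by
  have hK : TranslationLipschitz (max K 1) u := fun v =>
    (hu v).trans (by gcongr; exact le_max_left _ _)
  have hlt := (hK.gagliardo_rpow_two_le hs (by positivity)).trans_lt ENNReal.ofReal_lt_top
  exact (ENNReal.rpow_lt_top_iff_of_pos two_pos).1 hlt

end Interpolation

section Embedding

variable {N : ℕ} {s : ℝ} {Ω : Set (E N)}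

theorem Y.norm_sq_le_of_translationLipschitz [NeZero N] (hs : s ∈ Set.Ioo (0 : ℝ) 1) {K : ℝ}
    (hK : 0 < K) {y : Y s Ω} (hy : TranslationLipschitz K y.toL2) :
    ‖y‖ ^ 2 ≤ interpolationConst N s * K ^ (2 * s) * (2 * ‖y.toL2‖) ^ (2 - 2 * s) := by
  have hC : 0 ≤ interpolationConst N s := by
    have hs1 := sub_pos.2 hs.2
    have hs0 := hs.1
    rw [interpolationConst]
    positivity
  have h := ENNReal.toReal_le_of_le_ofReal (by positivity) (hy.gagliardo_rpow_two_le hs hK)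
  rwa [← ENNReal.toReal_rpow, Real.rpow_ofNat] at h

/-- The functions in `L²(ℝ^N)` that vanish outside `Ω` and satisfy `‖u(· + h) - u‖ ≤ |h|`: a compact
subset of `L²(ℝ^N)` that contains the unit ball of `X`. -/
def lipschitzBall (Ω : Set (E N)) : Set (L2 N) :=
  {u | u ∈ vanishingOutside Ω ∧ TranslationLipschitz 1 u}

/-- The elements of `lipschitzBall Ω` as elements of `Y`. -/
def lipschitzBall.toY [NeZero N] (hs : s ∈ Set.Ioo (0 : ℝ) 1) (u : lipschitzBall Ω) : Y s Ω :=
  ⟨u, u.2.2.mem_Hs hs, u.2.1⟩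

theorem lipschitzBall.continuous_toY [NeZero N] (hs : s ∈ Set.Ioo (0 : ℝ) 1) :
    Continuous (lipschitzBall.toY hs : lipschitzBall Ω → Y s Ω) := by
  refine continuous_iff_continuousAt.2 fun u => tendsto_iff_norm_sub_tendsto_zero.2 ?_
  have hexp : 0 < 2 - 2 * s := by linarith [hs.2]
  have hbound : ∀ v : lipschitzBall Ω, ‖toY hs v - toY hs u‖ ^ 2
      ≤ interpolationConst N s * (1 + 1) ^ (2 * s) * (2 * ‖(v : L2 N) - u‖) ^ (2 - 2 * s) :=
    fun v => Y.norm_sq_le_of_translationLipschitz hs (by norm_num) (v.2.2.sub u.2.2)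
  have hlim : Tendsto (fun v : lipschitzBall Ω =>
      interpolationConst N s * (1 + 1) ^ (2 * s) * (2 * ‖(v : L2 N) - u‖) ^ (2 - 2 * s))
      (𝓝 u) (𝓝 0) := by
    have hcont : Continuous fun v : lipschitzBall Ω =>
        interpolationConst N s * (1 + 1) ^ (2 * s) * (2 * ‖(v : L2 N) - u‖) ^ (2 - 2 * s) := by
      fun_prop (disch := exact hexp.le)
    simpa [Real.zero_rpow hexp.ne'] using hcont.tendsto u
  have hsq := squeeze_zero (fun v => sq_nonneg _) hbound hlim
  simpa using hsq.sqrt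

theorem lipschitzBall.isCompact_range_toY [NeZero N] (hs : s ∈ Set.Ioo (0 : ℝ) 1)
    (hΩ : Bornology.IsBounded Ω) :
    IsCompact (Set.range (lipschitzBall.toY hs : lipschitzBall Ω → Y s Ω)) := by
  have : CompactSpace (lipschitzBall Ω) := isCompact_iff_compactSpace.1
    (isCompact_setOf_translationLipschitz ENNReal.ofNat_ne_top 1 hΩ)
  exact isCompact_range (lipschitzBall.continuous_toY hs)

theorem X.translationLipschitz_toL2 (u : X Ω) : TranslationLipschitz ‖u‖ u.toL2 :=
  u.isWeakGradient_grad.translationLipschitz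

/-- The inclusion `X → Y`, `u ↦ u`. -/
def inclusion [NeZero N] (hs : s ∈ Set.Ioo (0 : ℝ) 1) (Ω : Set (E N)) : X Ω →ₗ[ℝ] Y s Ω where
  toFun u := ⟨u.toL2, u.translationLipschitz_toL2.mem_Hs hs, u.2.2⟩
  map_add' _ _ := rfl
  map_smul' _ _ := rfl

theorem X.toL2_mem_lipschitzBall {u : X Ω} (hu : ‖u‖ ≤ 1) : u.toL2 ∈ lipschitzBall Ω :=
  ⟨u.2.2, fun v => (u.translationLipschitz_toL2 v).trans (by gcongr)⟩

theorem isCompactOperator_inclusion [NeZero N] (hs : s ∈ Set.Ioo (0 : ℝ) 1)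
    (hΩ : Bornology.IsBounded Ω) : IsCompactOperator (inclusion hs Ω) := by
  refine ⟨_, lipschitzBall.isCompact_range_toY hs hΩ,
    mem_of_superset (Metric.closedBall_mem_nhds 0 one_pos) fun u hu => ?_⟩
  exact ⟨⟨u.toL2, X.toL2_mem_lipschitzBall (mem_closedBall_zero_iff.1 hu)⟩, rfl⟩

end Embedding

end MixedSobolev

end

theorem lemma1_general {N : ℕ} [NeZero N] {s : ℝ} (hs : s ∈ Set.Ioo (0 : ℝ) 1)
    {Ω : Set (MixedSobolev.E N)} (hΩ : Bornology.IsBounded Ω) :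
    ∃ ι : MixedSobolev.X Ω →L[ℝ] MixedSobolev.Y s Ω,
      (∀ u : MixedSobolev.X Ω, (ι u).toL2 = u.toL2) ∧ IsCompactOperator ι :=
  have hcompact := MixedSobolev.isCompactOperator_inclusion hs hΩ
  ⟨ContinuousLinearMap.mkOfIsCompactOperator hcompact, fun _ => rfl, hcompact⟩

theorem lemma1 (N : ℕ) (hN : 2 ≤ N) (s : ℝ) (hs : s ∈ Set.Ioo (0 : ℝ) 1)
    (Ω : Set (MixedSobolev.E N)) (hopen : IsOpen Ω) (hconn : IsConnected Ω)
    (hbdd : Bornology.IsBounded Ω) :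
    ∃ ι : MixedSobolev.X Ω →L[ℝ] MixedSobolev.Y s Ω,
      (∀ u : MixedSobolev.X Ω, (ι u).toL2 = u.toL2) ∧ IsCompactOperator ι := by
  have : NeZero N := ⟨by omega⟩
  exact lemma1_general hs hbdd
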